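/- A \emph{graphon} $(J,W)$ consists of a standard probability space $J$ (a standard Borel space with a probability measure $\pi$) and a symmetric measurable function $W\colon J\times J\to[0,1]$. Its \emph{neighborhood distance} is $r_W(x,y)=\int_J|W(x,z)-W(y,z)|\,d\pi(z)$. The graphon is \emph{pure} if $(J,r_W)$ is a complete metric space (so $r_W(x,y)=0$ only for $x=y$) and every nonempty $r_W$-open set has positive $\pi$-measure. With $(W\circ W)(x,y)=\int_J W(x,z)W(z,y)\,d\pi(z)$, the \emph{2-neighborhood (similarity) distance} is $$\bar r_W(x,y)=r_{W\circ W}(x,y)=\int_J\Bigl|\int_J (W(x,u)-W(y,u))W(u,z)\,d\pi(u)\Bigr|\,d\pi(z),$$ and $(\bar J,\bar r_W)$ denotes the completion of $(J,\bar r_W)$. An \emph{automorphism} of $(J,W)$ is a measure preserving bijection $\sigma\colon J\to J$ such that for every $x\in J$ the equality $W(\sigma(x),\sigma(y))=W(x,y)$ holds for almost all $y\in J$. The automorphisms form a group $\mathrm{Aut}(J,W)$ under composition. Every automorphism preserves $\bar r_W$ and hence extends uniquely to an isometry of $(\bar J,\bar r_W)$ onto itself, and $\mathrm{Aut}(J,W)$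 is given the topology of $d(\sigma,\tau)=\sup_{x\in\bar J}\bar r_W(\sigma(x),\tau(x))$. The isometry group $\mathrm{Isom}(\bar J,\bar r_W)$ (isometries of $\bar J$ onto itself) is given the topology of pointwise convergence. \textbf{Theorem.} Let $(J,W)$ be a pure graphon. Then: \begin{enumerate} \item $\bar r_W$ is a metric on $J$ (distinct points have positive distance), and the completion $(\bar J,\bar r_W)$ is compact; the group $\mathrm{Isom}(\bar J,\bar r_W)$ is compact as well. \item Extension $\sigma\mapsto\bar\sigma$ is an injective group homomorphism $\mathrm{Aut}(J,W)\to\mathrm{Isom}(\bar J,\bar r_W)$ that is a homeomorphism onto its image, and its image is closed; that is, the automorphisms form a closed subgroup of $\mathrm{Isom}(\bar J,\bar r_W)$. \item $d$ is a metric on $\mathrm{Aut}(J,W)$, and with its topology $\mathrm{Aut}(J,W)$ is a compact topological group. \end{enumerate} -/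

import Mathlib

open MeasureTheory Set

universe u

/-- A graphon on `J`: a probability measure `π` on `J` and a symmetric measurable function
`W : J × J → [0, 1]`. Used together with `[StandardBorelSpace J]`, so that `(J, π)` is a standard
probability space. -/
structure Graphon (J : Type u) [MeasurableSpace J] where
  π : Measure J
  isProb : IsProbabilityMeasure π
  W : J → J → ℝ
  measurable_W : Measurable (Function.uncurry W)
  symm : ∀ x y, W x y = W y x
  mem_Icc : ∀ x y, W x y ∈ Icc (0 : ℝ) 1

namespace Graphon

variable {J : Type u} [MeasurableSpace J]

instance (G : Graphon J) : IsProbabilityMeasure G.π := G.isProb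

theorem measurable_section (G : Graphon J) (x : J) : Measurable (G.W x) :=
  G.measurable_W.comp measurable_prodMk_left

theorem integrable_section (G : Graphon J) (x : J) : Integrable (G.W x) G.π :=
  Integrable.of_mem_Icc 0 1 (G.measurable_section x).aemeasurable
    (Filter.Eventually.of_forall (G.mem_Icc x))

theorem integrable_mul (G : Graphon J) (x y : J) :
    Integrable (fun z => G.W x z * G.W z y) G.π := by
  refine Integrable.of_mem_Icc 0 1 ?_ (Filter.Eventually.of_forall fun z => ?_)
  · exact ((G.measurable_section x).mul
      (G.measurable_W.comp measurable_prodMk_right)).aemeasurable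
  · exact ⟨mul_nonneg (G.mem_Icc x z).1 (G.mem_Icc z y).1,
      mul_le_one₀ (G.mem_Icc x z).2 (G.mem_Icc z y).1 (G.mem_Icc z y).2⟩

/-! ### The neighborhood distance and the 2-neighborhood (similarity) distance -/

/-- The neighborhood distance `r_W(x, y) = ∫ |W(x, z) - W(y, z)| dz`. -/
noncomputable def nbhdDist (G : Graphon J) (x y : J) : ℝ :=
  ∫ z, |G.W x z - G.W y z| ∂G.π

theorem integrable_abs_sub (G : Graphon J) (x y : J) :
    Integrable (fun z => |G.W x z - G.W y z|) G.π :=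
  ((G.integrable_section x).sub (G.integrable_section y)).abs

theorem nbhdDist_le_one (G : Graphon J) (x y : J) : G.nbhdDist x y ≤ 1 := by
  have h : G.nbhdDist x y ≤ ∫ _, (1 : ℝ) ∂G.π := by
    refine integral_mono (G.integrable_abs_sub x y) (integrable_const _) fun z => ?_
    have hx := G.mem_Icc x z
    have hy := G.mem_Icc y z
    exact abs_le.2 ⟨by linarith [hx.1, hy.2], by linarith [hx.2, hy.1]⟩
  simpa using h

/-- The space `J` with the neighborhood semimetric `r_W`. -/
def NbhdSpace (_G : Graphon J) : Type u := J

/-- A point of the graphon, seen as a point of the neighborhood space. -/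
def toNbhd (G : Graphon J) : J ≃ G.NbhdSpace := Equiv.refl J

noncomputable instance (G : Graphon J) : PseudoMetricSpace G.NbhdSpace where
  dist x y := G.nbhdDist (G.toNbhd.symm x) (G.toNbhd.symm y)
  dist_self x := by simp [nbhdDist]
  dist_comm x y := by simp only [nbhdDist, abs_sub_comm]
  dist_triangle x y z := by
    simp only [nbhdDist]
    rw [← integral_add (G.integrable_abs_sub _ _) (G.integrable_abs_sub _ _)]
    exact integral_mono (G.integrable_abs_sub _ _)
      ((G.integrable_abs_sub _ _).add (G.integrable_abs_sub _ _))
      fun t => abs_sub_le _ _ _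

theorem dist_toNbhd (G : Graphon J) (x y : J) :
    dist (G.toNbhd x) (G.toNbhd y) = G.nbhdDist x y := rfl

/-- The operator square `W ∘ W` of a graphon, `(W ∘ W)(x, y) = ∫ W(x, z) W(z, y) dz`. -/
noncomputable def square (G : Graphon J) : Graphon J where
  π := G.π
  isProb := G.isProb
  W x y := ∫ z, G.W x z * G.W z y ∂G.π
  measurable_W := by
    have h : Measurable fun p : (J × J) × J => G.W p.1.1 p.2 * G.W p.2 p.1.2 :=
      (G.measurable_W.comp ((measurable_fst.comp measurable_fst).prodMk measurable_snd)).mul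
        (G.measurable_W.comp (measurable_snd.prodMk (measurable_snd.comp measurable_fst)))
    exact (h.stronglyMeasurable.integral_prod_right' (ν := G.π)).measurable
  symm x y := by
    refine integral_congr_ae (Filter.Eventually.of_forall fun z => ?_)
    simp only [G.symm x z, G.symm z y, mul_comm]
  mem_Icc x y := by
    refine ⟨integral_nonneg fun z => mul_nonneg (G.mem_Icc x z).1 (G.mem_Icc z y).1, ?_⟩
    have h : ∫ z, G.W x z * G.W z y ∂G.π ≤ ∫ _, (1 : ℝ) ∂G.π :=
      integral_mono (G.integrable_mul x y) (integrable_const _) fun z =>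
        mul_le_one₀ (G.mem_Icc x z).2 (G.mem_Icc z y).1 (G.mem_Icc z y).2
    simpa using h

/-- The 2-neighborhood distance `r̄_W = r_{W ∘ W}`. -/
noncomputable def simDist (G : Graphon J) (x y : J) : ℝ := G.square.nbhdDist x y

theorem simDist_eq (G : Graphon J) (x y : J) :
    G.simDist x y = ∫ z, |∫ u, (G.W x u - G.W y u) * G.W u z ∂G.π| ∂G.π := by
  simp only [simDist, nbhdDist, square]
  refine integral_congr_ae (Filter.Eventually.of_forall fun z => ?_)
  simp only [sub_mul]
  rw [integral_sub (G.integrable_mul x z) (G.integrable_mul y z)]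

/-- The space `J` with the 2-neighborhood semimetric `r̄_W`. -/
abbrev SimSpace (G : Graphon J) : Type u := G.square.NbhdSpace

/-- A point of the graphon, seen as a point of the 2-neighborhood space. -/
noncomputable abbrev toSim (G : Graphon J) : J ≃ G.SimSpace := G.square.toNbhd

theorem dist_toSim (G : Graphon J) (x y : J) :
    dist (G.toSim x) (G.toSim y) = G.simDist x y := rfl

/-- The completion `(J̄, r̄_W)` of the 2-neighborhood space. -/
abbrev SimCompletion (G : Graphon J) : Type u := UniformSpace.Completion G.SimSpace

theorem dist_simCompletion_le_one (G : Graphon J) (x y : G.SimCompletion) : dist x y ≤ 1 := by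
  refine UniformSpace.Completion.induction_on₂ x y
    (isClosed_le continuous_dist continuous_const) fun a b => ?_
  rw [UniformSpace.Completion.dist_eq]
  exact G.square.nbhdDist_le_one _ _

/-- A graphon is pure if `(J, r_W)` is a complete metric space in which every nonempty open set
has positive measure. -/
structure IsPure (G : Graphon J) : Prop where
  eq_of_nbhdDist_eq_zero : ∀ x y : J, G.nbhdDist x y = 0 → x = y
  complete : CompleteSpace G.NbhdSpace
  full_support : ∀ U : Set G.NbhdSpace, IsOpen U → U.Nonempty → 0 < G.π (G.toNbhd ⁻¹' U)

/-! ### Automorphisms -/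

/-- Automorphisms: measure preserving bijections `σ : J → J` such that for every `x`,
`W(σ x, σ y) = W(x, y)` for almost all `y`. -/
def IsAutomorphism (G : Graphon J) (σ : Equiv.Perm J) : Prop :=
  MeasurePreserving σ G.π G.π ∧ ∀ x, ∀ᵐ y ∂G.π, G.W (σ x) (σ y) = G.W x y

theorem IsAutomorphism.one (G : Graphon J) : G.IsAutomorphism 1 :=
  ⟨MeasurePreserving.id _, fun _ => Filter.Eventually.of_forall fun _ => rfl⟩

theorem IsAutomorphism.mul {G : Graphon J} {σ τ : Equiv.Perm J}
    (hσ : G.IsAutomorphism σ) (hτ : G.IsAutomorphism τ) : G.IsAutomorphism (σ * τ) := by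
  refine ⟨hσ.1.comp hτ.1, fun x => ?_⟩
  filter_upwards [hτ.1.quasiMeasurePreserving.ae (hσ.2 (τ x)), hτ.2 x] with y h1 h2
  exact h1.trans h2

theorem IsAutomorphism.inv [StandardBorelSpace J] {G : Graphon J} {σ : Equiv.Perm J}
    (hσ : G.IsAutomorphism σ) : G.IsAutomorphism σ⁻¹ := by
  have hemb : MeasurableEmbedding σ := hσ.1.measurable.measurableEmbedding σ.injective
  have hmeas : Measurable (σ⁻¹ : Equiv.Perm J) := by
    intro s hs
    have : (σ⁻¹ : Equiv.Perm J) ⁻¹' s = σ '' s := (σ.image_eq_preimage_symm s).symm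
    rw [this]
    exact hemb.measurableSet_image.2 hs
  have hinv : MeasurePreserving (σ⁻¹ : Equiv.Perm J) G.π G.π := by
    refine ⟨hmeas, ?_⟩
    conv_lhs => rw [← hσ.1.map_eq]
    rw [Measure.map_map hmeas hσ.1.measurable]
    have : (σ⁻¹ : Equiv.Perm J) ∘ σ = id := by ext x; simp
    rw [this, Measure.map_id]
  refine ⟨hinv, fun x => ?_⟩
  filter_upwards [hinv.quasiMeasurePreserving.ae (hσ.2 (σ⁻¹ x))] with y hy
  simpa using hy.symm

/-- An automorphism preserves the distance `r_W`. -/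
theorem IsAutomorphism.nbhdDist_eq [StandardBorelSpace J] {G : Graphon J} {σ : Equiv.Perm J}
    (hσ : G.IsAutomorphism σ) (x y : J) : G.nbhdDist (σ x) (σ y) = G.nbhdDist x y := by
  have hemb : MeasurableEmbedding σ := hσ.1.measurable.measurableEmbedding σ.injective
  simp only [nbhdDist]
  rw [← hσ.1.integral_comp hemb]
  refine integral_congr_ae ?_
  filter_upwards [hσ.2 x, hσ.2 y] with z h1 h2
  rw [h1, h2]

/-- An automorphism of `W` is an automorphism of `W ∘ W`. -/
theorem IsAutomorphism.square [StandardBorelSpace J] {G : Graphon J} {σ : Equiv.Perm J}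
    (hσ : G.IsAutomorphism σ) : G.square.IsAutomorphism σ := by
  have hemb : MeasurableEmbedding σ := hσ.1.measurable.measurableEmbedding σ.injective
  refine ⟨hσ.1, fun x => Filter.Eventually.of_forall fun y => ?_⟩
  simp only [Graphon.square]
  rw [← hσ.1.integral_comp hemb]
  refine integral_congr_ae ?_
  filter_upwards [hσ.2 x, hσ.2 y] with z h1 h2
  rw [h1, G.symm (σ z), h2, G.symm y]

variable [StandardBorelSpace J]

/-- The automorphisms form a subgroup of the group of all permutations of `J`. -/
def autSubgroup (G : Graphon J) : Subgroup (Equiv.Perm J) where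
  carrier := {σ | G.IsAutomorphism σ}
  one_mem' := IsAutomorphism.one G
  mul_mem' h1 h2 := h1.mul h2
  inv_mem' h := h.inv

/-- The automorphism group of a graphon. -/
def Aut (G : Graphon J) : Type u := G.autSubgroup

instance (G : Graphon J) : Group G.Aut := inferInstanceAs (Group G.autSubgroup)

/-- The permutation of `J` underlying an automorphism. -/
def Aut.toPerm {G : Graphon J} (σ : G.Aut) : Equiv.Perm J := Subtype.val σ

/-- An automorphism as an isometry of the space `(J, r̄_W)`. -/
noncomputable def Aut.toSimIsometry {G : Graphon J} (σ : G.Aut) : G.SimSpace ≃ᵢ G.SimSpace where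
  toEquiv := G.toSim.permCongr σ.toPerm
  isometry_toFun := Isometry.of_dist_eq fun x y =>
    (IsAutomorphism.square σ.2).nbhdDist_eq (G.toSim.symm x) (G.toSim.symm y)

/-- An automorphism as a uniform isomorphism of the space `(J, r̄_W)`. -/
noncomputable def Aut.toSimUniform {G : Graphon J} (σ : G.Aut) : G.SimSpace ≃ᵤ G.SimSpace where
  toEquiv := σ.toSimIsometry.toEquiv
  uniformContinuous_toFun := σ.toSimIsometry.isometry.uniformContinuous
  uniformContinuous_invFun := σ.toSimIsometry.symm.isometry.uniformContinuous

/-- The isometry of `(J̄, r̄_W)` that extends an automorphism by continuity. -/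
noncomputable def Aut.extend {G : Graphon J} (σ : G.Aut) :
    G.SimCompletion ≃ᵢ G.SimCompletion where
  toEquiv := (UniformSpace.Completion.mapEquiv σ.toSimUniform).toEquiv
  isometry_toFun := σ.toSimIsometry.isometry.completion_map

theorem Aut.extend_coe {G : Graphon J} (σ : G.Aut) (x : J) :
    σ.extend (G.toSim x : G.SimCompletion) = (G.toSim (σ.toPerm x) : G.SimCompletion) :=
  UniformSpace.Completion.map_coe σ.toSimIsometry.isometry.uniformContinuous (G.toSim x)

/-- The homomorphism from the automorphism group to the isometry group of `(J̄, r̄_W)`. -/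
noncomputable def extendHom (G : Graphon J) :
    G.Aut →* (G.SimCompletion ≃ᵢ G.SimCompletion) :=
  MonoidHom.mk' Aut.extend fun σ τ => by
    ext x
    refine UniformSpace.Completion.induction_on x
      (isClosed_eq (IsometryEquiv.continuous _) (IsometryEquiv.continuous _)) fun a => ?_
    obtain ⟨a, rfl⟩ := G.toSim.surjective a
    rw [IsometryEquiv.mul_apply, Aut.extend_coe, Aut.extend_coe, Aut.extend_coe]
    rfl

theorem bddAbove_dist_extend {G : Graphon J} (σ τ : G.Aut) :
    BddAbove (range fun x : G.SimCompletion => dist (σ.extend x) (τ.extend x)) :=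
  ⟨1, by rintro _ ⟨x, rfl⟩; exact G.dist_simCompletion_le_one _ _⟩

/-- The metric `d(σ, τ) = sup_{x ∈ J̄} r̄_W(σ x, τ x)` on the automorphism group, which also
gives this group its topology. -/
noncomputable instance (G : Graphon J) : PseudoMetricSpace G.Aut where
  dist σ τ := ⨆ x : G.SimCompletion, dist (σ.extend x) (τ.extend x)
  dist_self σ := by simp
  dist_comm σ τ := by simp only [dist_comm]
  dist_triangle σ τ ρ := by
    refine Real.iSup_le (fun x => ?_) (add_nonneg (Real.iSup_nonneg fun _ => dist_nonneg)
      (Real.iSup_nonneg fun _ => dist_nonneg))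
    exact (dist_triangle _ (τ.extend x) _).trans
      (add_le_add (le_ciSup (bddAbove_dist_extend σ τ) x) (le_ciSup (bddAbove_dist_extend τ ρ) x))

theorem dist_aut {G : Graphon J} (σ τ : G.Aut) :
    dist σ τ = ⨆ x : G.SimCompletion, dist (σ.extend x) (τ.extend x) := rfl

end Graphon

/-- The topology of pointwise convergence on the isometry group of a metric space. -/
instance isometryPointwiseTopology (X : Type u) [PseudoMetricSpace X] :
    TopologicalSpace (X ≃ᵢ X) :=
  TopologicalSpace.induced (fun (φ : X ≃ᵢ X) (x : X) => φ x) inferInstance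

/-! `W ∘ W` is more regular than `W`: it is 1-Lipschitz for `r_W` in each variable. If `r̄_W(x, y) =
0`, the sections of `W ∘ W` at `x` and `y` agree almost everywhere, hence everywhere by full
support, and `∫ (W(x, u) - W(y, u))² du = 0`. Compactness of the completion is total boundedness:
`r_W` is an `L¹` distance, hence separable, so finitely many small balls cover `J` up to small
measure, and the rounded values of `(W ∘ W)(x, ·)` at their centres locate `x` for `r̄_W`. The
isometry group is then compact by Tychonoff, and its pointwise and uniform topologies agree.

The main point is that the image of the automorphisms is closed: a limit `φ` might move points of
`J` outside `J`. Transport `π` and `W` to the completion. Then `φ` preserves the measure, tested on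
continuous functions, and preserves `W` almost everywhere on the product, by `L¹` approximation. By
Fubini, almost every `x` is sent into `J` with its section preserved. On such points `φ` preserves
`r_W`; they are `r_W`-dense by purity, and completeness of `r_W` reaches every `x`
(`IsAutLimit.exists_isAutPoint`). The same for `φ⁻¹` gives a bijection of `J`. -/

/-! ### Isometries of compact metric spaces -/

/-- An isometric self-map of a compact metric space is surjective. -/
theorem Isometry.surjective_of_compactSpace {X : Type*} [MetricSpace X] [CompactSpace X]
    {f : X → X} (hf : Isometry f) : Function.Surjective f := by
  intro y
  by_contra hy
  have hy' : y ∉ range f := hy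
  have hcl : IsClosed (range f) := (isCompact_range hf.continuous).isClosed
  obtain ⟨δ, hδ, hball⟩ := Metric.isOpen_iff.1 hcl.isOpen_compl y hy'
  have hsep : ∀ z, δ ≤ dist (f z) y := fun z => by
    by_contra h
    exact hball (Metric.mem_ball.2 (not_le.1 h)) (mem_range_self z)
  -- Cancelling `f^[n]` compares `y` with a point of the range, so the orbit of `y` is `δ`-separated
  -- and has no Cauchy subsequence.
  have hiter : ∀ n k, δ ≤ dist (f^[n + (k + 1)] y) (f^[n] y) := fun n k => by
    have hfn : Isometry f^[n] := by
      induction n with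
      | zero => exact isometry_id
      | succ n ih => exact ih.comp hf
    rw [Function.iterate_add_apply, hfn.dist_eq, Function.iterate_succ_apply']
    exact hsep _
  obtain ⟨a, -, u, hu, ha⟩ := isCompact_univ.tendsto_subseq fun n => mem_univ (f^[n] y)
  obtain ⟨N, hN⟩ := Metric.cauchySeq_iff.1 ha.cauchySeq δ hδ
  have h1 := hN (N + 1) (by omega) N le_rfl
  obtain ⟨k, hk⟩ := Nat.exists_eq_add_of_lt (hu (Nat.lt_succ_self N))
  simp only [Function.comp_apply] at h1
  rw [Nat.succ_eq_add_one, add_assoc] at hk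
  rw [hk] at h1
  exact absurd h1 (not_lt.2 (hiter _ _))

/-- The isometry group of a compact metric space is compact for pointwise convergence. -/
theorem IsometryEquiv.compactSpace {X : Type*} [MetricSpace X] [CompactSpace X] :
    CompactSpace (X ≃ᵢ X) := by
  have hind : Topology.IsInducing (fun (φ : X ≃ᵢ X) (x : X) => φ x) := ⟨rfl⟩
  -- By automatic surjectivity the group is all of the isometric self-maps, a closed subset of the
  -- compact product.
  have hrange : range (fun (φ : X ≃ᵢ X) (x : X) => φ x) = {f : X → X | Isometry f} := by
    ext f
    constructor
    · rintro ⟨φ, rfl⟩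
      exact φ.isometry
    · intro hf
      exact ⟨⟨Equiv.ofBijective f ⟨hf.injective, hf.surjective_of_compactSpace⟩, hf⟩, rfl⟩
  have hclosed : IsClosed {f : X → X | Isometry f} := by
    simp only [isometry_iff_dist_eq, ofPred_forall]
    exact isClosed_iInter fun x => isClosed_iInter fun y =>
      isClosed_eq (by fun_prop) continuous_const
  rw [← isCompact_univ_iff, hind.isCompact_iff, image_univ, hrange]
  exact hclosed.isCompact

/-- Uniform neighborhoods are neighborhoods for the pointwise topology on the isometry group of a
compact space. -/
theorem IsometryEquiv.setOf_forall_dist_lt_mem_nhds {X : Type*} [PseudoMetricSpace X]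
    [CompactSpace X] (φ : X ≃ᵢ X) {ε : ℝ} (hε : 0 < ε) :
    {ψ : X ≃ᵢ X | ∀ x, dist (ψ x) (φ x) < ε} ∈ nhds φ := by
  obtain ⟨t, -, htf, ht⟩ := finite_cover_balls_of_compact (isCompact_univ (X := X))
    (e := ε / 3) (by positivity)
  have hcont : ∀ x, Continuous fun ψ : X ≃ᵢ X => ψ x := fun x =>
    (continuous_apply x).comp continuous_induced_dom
  have hmem : ∀ᶠ ψ in nhds φ, ∀ x ∈ t, dist (ψ x) (φ x) < ε / 3 :=
    (Filter.eventually_all_finite htf).2 fun x _ =>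
      (hcont x).continuousAt.eventually (Metric.ball_mem_nhds _ (by positivity))
  filter_upwards [hmem] with ψ hψ x
  obtain ⟨y, hy, hxy⟩ := mem_iUnion₂.1 (ht (mem_univ x))
  have hxy' : dist x y < ε / 3 := hxy
  have h1 := dist_triangle4 (ψ x) (ψ y) (φ y) (φ x)
  rw [ψ.dist_eq, φ.dist_eq, dist_comm y x] at h1
  linarith [hψ y hy]

/-! ### Uniform limits of measure preserving maps -/

/-- A uniform limit of measure preserving maps is measure preserving. -/
theorem MeasureTheory.MeasurePreserving.of_forall_exists_dist_lt {Y : Type*} [MetricSpace Y]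
    [CompactSpace Y] [MeasurableSpace Y] [BorelSpace Y] {μ : Measure Y} [IsFiniteMeasure μ]
    {f : Y → Y} (hf : Continuous f)
    (h : ∀ ε > 0, ∃ g : Y → Y, MeasurePreserving g μ μ ∧ ∀ y, dist (g y) (f y) < ε) :
    MeasurePreserving f μ μ := by
  refine ⟨hf.measurable, ?_⟩
  have := Measure.isFiniteMeasure_map μ f
  refine ext_of_forall_integral_eq_of_IsFiniteMeasure fun k => ?_
  rw [integral_map hf.aemeasurable k.continuous.aestronglyMeasurable]
  have hk := CompactSpace.uniformContinuous_of_continuous k.continuous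
  refine eq_of_forall_dist_le fun ε hε => ?_
  -- The `+ 1` keeps the denominator positive even for the zero measure.
  obtain ⟨δ, hδ, hkδ⟩ := Metric.uniformContinuous_iff.1 hk (ε / (μ.real univ + 1)) (by positivity)
  obtain ⟨g, hg, hgf⟩ := h δ hδ
  have hint : ∫ y, k y ∂μ = ∫ y, k (g y) ∂μ := by
    conv_lhs => rw [← hg.map_eq]
    exact integral_map hg.measurable.aemeasurable k.continuous.aestronglyMeasurable
  have i1 : Integrable (fun y => k (f y)) μ :=
    (BoundedContinuousFunction.integrable μ (k.compContinuous ⟨f, hf⟩))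
  have i2 : Integrable (fun y => k (g y)) μ := hg.integrable_comp_of_integrable (k.integrable μ)
  rw [hint, dist_eq_norm, ← integral_sub i1 i2]
  refine (norm_integral_le_of_norm_le_const (C := ε / (μ.real univ + 1))
    (Filter.Eventually.of_forall fun y => ?_)).trans ?_
  · rw [← dist_eq_norm]
    exact (hkδ (by rw [dist_comm]; exact hgf y)).le
  · rw [div_mul_eq_mul_div, div_le_iff₀ (by positivity)]
    nlinarith [measureReal_nonneg (μ := μ) (s := univ)]

/-- A function invariant under measure preserving maps is invariant under their uniform limits. -/
theorem MeasureTheory.MeasurePreserving.comp_ae_eq_of_forall_exists_dist_lt {Y : Type*}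
    [MetricSpace Y] [CompactSpace Y] [MeasurableSpace Y] [BorelSpace Y] {μ : Measure Y}
    [IsFiniteMeasure μ] {f : Y → Y} (hf : MeasurePreserving f μ μ) {F : Y → ℝ}
    (hF : Integrable F μ)
    (h : ∀ ε > 0, ∃ g : Y → Y, MeasurePreserving g μ μ ∧ F ∘ g =ᵐ[μ] F ∧
      ∀ y, dist (g y) (f y) < ε) :
    F ∘ f =ᵐ[μ] F := by
  have iF : Integrable (F ∘ f) μ := hf.integrable_comp_of_integrable hF
  have key : ∫ y, |F (f y) - F y| ∂μ = 0 := by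
    refine le_antisymm (le_of_forall_pos_le_add fun ε hε => ?_)
      (integral_nonneg fun _ => abs_nonneg _)
    obtain ⟨k, hk, ik⟩ := hF.exists_boundedContinuous_integral_sub_le (ε := ε / 3) (by positivity)
    have huk := CompactSpace.uniformContinuous_of_continuous k.continuous
    obtain ⟨δ, hδ, hkδ⟩ := Metric.uniformContinuous_iff.1 huk (ε / 3 / (μ.real univ + 1))
      (by positivity)
    obtain ⟨g, hg, hFg, hgf⟩ := h δ hδ
    have iD : Integrable (fun y => ‖F y - k y‖) μ := (hF.sub ik).norm
    have i1 : Integrable (fun y => ‖F (f y) - k (f y)‖) μ := hf.integrable_comp_of_integrable iD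
    have i2 : Integrable (fun y => ‖F (g y) - k (g y)‖) μ := hg.integrable_comp_of_integrable iD
    -- Since `f` and `g` preserve `μ`, the error of approximating `F` by `k` does not grow under
    -- composition.
    have e1 : ∫ y, ‖F (f y) - k (f y)‖ ∂μ = ∫ y, ‖F y - k y‖ ∂μ := by
      conv_rhs => rw [← hf.map_eq]
      exact (integral_map hf.measurable.aemeasurable
        (by rw [hf.map_eq]; exact iD.aestronglyMeasurable)).symm
    have e2 : ∫ y, ‖F (g y) - k (g y)‖ ∂μ = ∫ y, ‖F y - k y‖ ∂μ := by
      conv_rhs => rw [← hg.map_eq]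
      exact (integral_map hg.measurable.aemeasurable
        (by rw [hg.map_eq]; exact iD.aestronglyMeasurable)).symm
    have hle : ∫ y, |F (f y) - F y| ∂μ ≤ ∫ y, (‖F (f y) - k (f y)‖ + ε / 3 / (μ.real univ + 1) +
        ‖F (g y) - k (g y)‖) ∂μ := by
      refine integral_mono_ae (iF.sub hF).abs ((i1.add (integrable_const _)).add i2) ?_
      filter_upwards [hFg] with y hy
      have h1 := hkδ (hgf y)
      rw [Real.dist_eq] at h1
      simp only [Function.comp_apply] at hy
      simp only [Real.norm_eq_abs]
      rw [← hy]
      have h2 := abs_sub_le (F (f y)) (k (f y)) (F (g y))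
      have h3 := abs_sub_le (k (f y)) (k (g y)) (F (g y))
      rw [abs_sub_comm (k (f y)) (k (g y)), abs_sub_comm (k (g y)) (F (g y))] at h3
      linarith
    have i3 : Integrable (fun y => ‖F (f y) - k (f y)‖ + ε / 3 / (μ.real univ + 1)) μ :=
      i1.add (integrable_const _)
    rw [integral_add i3 i2, integral_add i1 (integrable_const _), e1, e2,
      integral_const, smul_eq_mul] at hle
    have : μ.real univ * (ε / 3 / (μ.real univ + 1)) ≤ ε / 3 := by
      rw [mul_div_assoc', div_le_iff₀ (by positivity)]
      nlinarith [measureReal_nonneg (μ := μ) (s := univ)]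
    linarith
  have := (integral_eq_zero_iff_of_nonneg (fun _ => abs_nonneg _) (iF.sub hF).abs).1 key
  filter_upwards [this] with y hy
  exact sub_eq_zero.1 (abs_eq_zero.1 hy)

/-! ### Separation and total boundedness for the similarity distance -/

namespace Graphon

variable {J : Type*} [MeasurableSpace J] (G : Graphon J)

theorem measurable_nbhdDist : Measurable fun p : J × J => G.nbhdDist p.1 p.2 := by
  have h : Measurable fun p : (J × J) × J => |G.W p.1.1 p.2 - G.W p.1.2 p.2| :=
    ((G.measurable_W.comp ((measurable_fst.comp measurable_fst).prodMk measurable_snd)).sub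
      (G.measurable_W.comp ((measurable_snd.comp measurable_fst).prodMk measurable_snd))).abs
  exact (h.stronglyMeasurable.integral_prod_right' (ν := G.π)).measurable

/-- Since `0 ≤ W ≤ 1`, integrating against `W(·, z)` turns `L¹` closeness of sections of `W` into
uniform closeness of sections of `W ∘ W`. -/
theorem abs_square_sub_le (x y z : J) :
    |G.square.W x z - G.square.W y z| ≤ G.nbhdDist x y := by
  simp only [square, nbhdDist]
  rw [← integral_sub (G.integrable_mul x z) (G.integrable_mul y z)]
  refine abs_integral_le_integral_abs.trans (integral_mono
    ((G.integrable_mul x z).sub (G.integrable_mul y z)).abs (G.integrable_abs_sub x y) fun u => ?_)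
  simp only [← sub_mul, abs_mul, abs_of_nonneg (G.mem_Icc u z).1]
  exact mul_le_of_le_one_right (abs_nonneg _) (G.mem_Icc u z).2

theorem abs_square_sub_le_right (x z w : J) :
    |G.square.W x z - G.square.W x w| ≤ G.nbhdDist z w := by
  rw [G.square.symm x z, G.square.symm x w]
  exact G.abs_square_sub_le z w x

theorem simDist_le_nbhdDist (x y : J) : G.simDist x y ≤ G.nbhdDist x y := by
  have h := integral_mono (G.square.integrable_abs_sub x y)
    (integrable_const (G.nbhdDist x y)) (G.abs_square_sub_le x y)
  rwa [integral_const, probReal_univ, one_smul] at h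

theorem continuous_square (x : J) :
    Continuous fun z : G.NbhdSpace => G.square.W x (G.toNbhd.symm z) :=
  (LipschitzWith.of_dist_le' (K := 1) fun z w => by
    rw [one_mul, Real.dist_eq]
    exact G.abs_square_sub_le_right x _ _).continuous

theorem IsPure.eq_of_simDist_eq_zero {G : Graphon J} (hG : G.IsPure) {x y : J}
    (h : G.simDist x y = 0) : x = y := by
  have hae : ∀ᵐ z ∂G.π, |G.square.W x z - G.square.W y z| = 0 :=
    (integral_eq_zero_iff_of_nonneg (fun _ => abs_nonneg _)
      (G.square.integrable_abs_sub x y)).1 h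
  -- The set where the two sections differ is `r_W`-open and null, hence empty.
  have hall : ∀ z, G.square.W x z = G.square.W y z := by
    intro z
    by_contra hz
    have hopen : IsOpen {z : G.NbhdSpace | G.square.W x (G.toNbhd.symm z) ≠
        G.square.W y (G.toNbhd.symm z)} :=
      isOpen_ne_fun (G.continuous_square x) (G.continuous_square y)
    refine (hG.full_support _ hopen ⟨G.toNbhd z, hz⟩).ne' ?_
    refine measure_mono_null (fun w hw => ?_) (ae_iff.1 hae)
    exact fun h0 => hw (sub_eq_zero.1 (abs_eq_zero.1 h0))
  refine hG.eq_of_nbhdDist_eq_zero x y ?_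
  -- Expanding the square leaves only values of `W ∘ W` at `x` and `y`, which cancel by `hall x` and
  -- `hall y`.
  have hsq : ∫ u, (G.W x u - G.W y u) ^ 2 ∂G.π = 0 := by
    have e : ∀ u, (G.W x u - G.W y u) ^ 2 =
        (G.W x u * G.W u x - G.W y u * G.W u x) - (G.W x u * G.W u y - G.W y u * G.W u y) := by
      intro u
      rw [G.symm u x, G.symm u y]
      ring
    have i1 : ∀ z, Integrable (fun u => G.W x u * G.W u z - G.W y u * G.W u z) G.π := fun z =>
      (G.integrable_mul x z).sub (G.integrable_mul y z)
    simp only [e]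
    rw [integral_sub (i1 x) (i1 y),
      integral_sub (G.integrable_mul x x) (G.integrable_mul y x),
      integral_sub (G.integrable_mul x y) (G.integrable_mul y y)]
    have h1 := hall x
    have h2 := hall y
    simp only [square] at h1 h2
    rw [h1, h2]
    ring
  have hint : Integrable (fun u => (G.W x u - G.W y u) ^ 2) G.π := by
    refine Integrable.of_mem_Icc 0 1
      (((G.measurable_section x).sub (G.measurable_section y)).pow_const 2).aemeasurable
      (Filter.Eventually.of_forall fun u => ⟨sq_nonneg _, ?_⟩)
    have h1 := G.mem_Icc x u
    have h2 := G.mem_Icc y u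
    exact (sq_le_one_iff_abs_le_one _).2
      (abs_le.2 ⟨by linarith [h1.1, h2.2], by linarith [h1.2, h2.1]⟩)
  have h0 := (integral_eq_zero_iff_of_nonneg (fun _ => sq_nonneg _) hint).1 hsq
  refine integral_eq_zero_of_ae ?_
  filter_upwards [h0] with u hu
  have : G.W x u - G.W y u = 0 := pow_eq_zero_iff two_ne_zero |>.1 hu
  simp [this]

/-- The neighborhood distance is the `L¹` distance of the sections of `W`. -/
theorem isometry_toL1 :
    Isometry fun x : G.NbhdSpace => (G.integrable_section (G.toNbhd.symm x)).toL1 _ := by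
  refine Isometry.of_dist_eq fun x y => ?_
  rw [dist_eq_norm, ← Integrable.toL1_sub, L1.norm_of_fun_eq_integral_norm]
  rfl

instance [StandardBorelSpace J] : TopologicalSpace.SeparableSpace G.NbhdSpace :=
  have : Fact ((1 : ENNReal) ≠ ⊤) := ⟨ENNReal.one_ne_top⟩
  have := G.isometry_toL1.isUniformInducing.isInducing.secondCountableTopology
  inferInstance

theorem totallyBounded_simSpace [StandardBorelSpace J] :
    TotallyBounded (univ : Set G.SimSpace) := by
  have : Nonempty J := by
    by_contra h
    rw [not_nonempty_iff] at h
    exact zero_ne_one ((Measure.eq_zero_of_isEmpty G.π ▸ measure_univ (μ := G.π)))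
  have : Nonempty G.NbhdSpace := this
  set c : ℕ → G.NbhdSpace := TopologicalSpace.denseSeq G.NbhdSpace
  have hc : DenseRange c := TopologicalSpace.denseRange_denseSeq _
  refine Metric.totallyBounded_of_finite_discretization fun ε hε => ?_
  -- The points missed by the first `n` balls of radius `ε / 8` about the dense sequence; their
  -- measure tends to zero.
  set s : ℕ → Set J := fun n => {z | ∀ k < n, ε / 8 ≤ G.nbhdDist (c k) z}
  have hs : ∀ n, MeasurableSet (s n) := fun n => by
    simp only [s, ofPred_forall]
    exact MeasurableSet.iInter fun k => MeasurableSet.iInter fun _ =>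
      measurableSet_le measurable_const (G.measurable_nbhdDist.comp measurable_prodMk_left)
  have hanti : Antitone s := fun m n hmn z hz k hk => hz k (hk.trans_le hmn)
  have hempty : ⋂ n, s n = ∅ := by
    refine eq_empty_of_forall_notMem fun z hz => ?_
    obtain ⟨k, hk⟩ := hc.exists_dist_lt (G.toNbhd z) (show 0 < ε / 8 by positivity)
    rw [dist_comm] at hk
    exact absurd (mem_iInter.1 hz (k + 1) k k.lt_succ_self) (not_le.2 hk)
  have hlim := tendsto_measure_iInter_atTop (μ := G.π) (fun n => (hs n).nullMeasurableSet) hanti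
    ⟨0, measure_ne_top _ _⟩
  rw [hempty, measure_empty] at hlim
  obtain ⟨N, hN⟩ := (hlim.eventually (gt_mem_nhds
    (show (0 : ENNReal) < ENNReal.ofReal (ε / 4) by simpa using hε))).exists
  simp only [Function.comp_apply] at hN
  have hN' : G.π.real (s N) ≤ ε / 4 := ENNReal.toReal_le_of_le_ofReal (by positivity) hN.le
  have hbd : ∀ (x : J) (k : Fin N), ⌊G.square.W x (c k) / (ε / 4)⌋₊ < ⌊1 / (ε / 4)⌋₊ + 1 :=
    fun x k => Nat.lt_succ_of_le (Nat.floor_le_floor (by gcongr; exact (G.square.mem_Icc x _).2))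
  -- Points are classified by the values of `W ∘ W` at the first `N` centres, rounded down to
  -- multiples of `ε / 4`.
  refine ⟨ULift (Fin N → Fin (⌊1 / (ε / 4)⌋₊ + 1)), inferInstance,
    fun x => ⟨fun k => ⟨⌊G.square.W (G.toSim.symm x.1) (c k) / (ε / 4)⌋₊, hbd _ k⟩⟩, ?_⟩
  rintro ⟨x, _⟩ ⟨y, _⟩ hxy
  have hxy' : ∀ k < N, |G.square.W x (c k) - G.square.W y (c k)| ≤ ε / 4 := by
    intro k hk
    have h1 : ⌊G.square.W x (c k) / (ε / 4)⌋₊ = ⌊G.square.W y (c k) / (ε / 4)⌋₊ :=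
      congrArg Fin.val (congrFun (congrArg ULift.down hxy) ⟨k, hk⟩)
    have hx0 : 0 ≤ G.square.W x (c k) / (ε / 4) := div_nonneg (G.square.mem_Icc _ _).1 (by positivity)
    have hy0 : 0 ≤ G.square.W y (c k) / (ε / 4) := div_nonneg (G.square.mem_Icc _ _).1 (by positivity)
    have a1 := Nat.floor_le hx0
    have a2 := Nat.lt_floor_add_one (G.square.W x (c k) / (ε / 4))
    have b1 := Nat.floor_le hy0
    have b2 := Nat.lt_floor_add_one (G.square.W y (c k) / (ε / 4))
    rw [h1] at a1 a2
    have h2 : |G.square.W x (c k) / (ε / 4) - G.square.W y (c k) / (ε / 4)| ≤ 1 :=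
      abs_le.2 ⟨by linarith, by linarith⟩
    rwa [← sub_div, abs_div, abs_of_pos (show 0 < ε / 4 by positivity), div_le_one (by positivity)]
      at h2
  -- Off `s N` the bound is `ε / 4` at a centre plus twice `ε / 8` for moving there; on `s N`, of
  -- measure at most `ε / 4`, the trivial bound `1` suffices.
  have hpt : ∀ z, |G.square.W x z - G.square.W y z| ≤ ε / 2 + (s N).indicator 1 z := by
    intro z
    by_cases hz : z ∈ s N
    · rw [indicator_of_mem hz, Pi.one_apply]
      have h1 := G.square.mem_Icc x z
      have h2 := G.square.mem_Icc y z
      exact abs_le.2 ⟨by linarith [h1.1, h2.2], by linarith [h1.2, h2.1]⟩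
    · rw [indicator_of_notMem hz]
      simp only [s, mem_ofPred_eq, not_forall, not_le] at hz
      obtain ⟨k, hk, hkz⟩ := hz
      have h1 := hxy' k hk
      have h2 := G.abs_square_sub_le_right x (c k) z
      have h3 := G.abs_square_sub_le_right y (c k) z
      rw [abs_le] at *
      constructor <;> linarith [h1.1, h1.2, h2.1, h2.2, h3.1, h3.2]
  have hind : Integrable ((s N).indicator (1 : J → ℝ)) G.π :=
    (integrable_const (1 : ℝ)).indicator (hs N)
  have hle := integral_mono (G.square.integrable_abs_sub x y)
    ((integrable_const (ε / 2)).add hind) hpt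
  have e : ∫ z, (ε / 2 + (s N).indicator 1 z) ∂G.π = ε / 2 + G.π.real (s N) := by
    rw [integral_add (integrable_const _) hind, integral_indicator_one (hs N)]
    simp
  have : dist (α := G.SimSpace) x y = ∫ z, |G.square.W x z - G.square.W y z| ∂G.π := rfl
  change dist (α := G.SimSpace) x y < ε
  rw [this]
  refine lt_of_le_of_lt (hle.trans e.le) ?_
  linarith

instance [StandardBorelSpace J] : CompactSpace G.SimCompletion := by
  have h := (G.totallyBounded_simSpace.image
    (UniformSpace.Completion.uniformContinuous_coe G.SimSpace)).closure
  rw [image_univ, UniformSpace.Completion.denseRange_coe.closure_range] at h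
  exact isCompact_univ_iff.1 (isCompact_iff_totallyBounded_isComplete.2 ⟨h, isClosed_univ.isComplete⟩)

end Graphon

/-! ### Transport of the graphon to the completion -/

namespace Graphon

variable {J : Type*} [MeasurableSpace J] (G : Graphon J)

noncomputable instance : MeasurableSpace G.SimCompletion := borel _

instance : BorelSpace G.SimCompletion := ⟨rfl⟩

/-- The canonical map from the points of a graphon to the completion of `(J, r̄_W)`. -/
noncomputable def embed (x : J) : G.SimCompletion := (G.toSim x : G.SimCompletion)

theorem dist_embed (x y : J) : dist (G.embed x) (G.embed y) = G.simDist x y :=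
  UniformSpace.Completion.dist_eq _ _

theorem continuous_embed_nbhd :
    Continuous fun x : G.NbhdSpace => G.embed (G.toNbhd.symm x) :=
  (LipschitzWith.of_dist_le' (K := 1) fun x y => by
    rw [one_mul, dist_embed]
    exact G.simDist_le_nbhdDist _ _).continuous

theorem denseRange_embed : DenseRange G.embed :=
  UniformSpace.Completion.denseRange_coe.comp G.toSim.surjective.denseRange
    (UniformSpace.Completion.continuous_coe _)

theorem isometryEquiv_ext_embed {φ ψ : G.SimCompletion ≃ᵢ G.SimCompletion}
    (h : ∀ x, φ (G.embed x) = ψ (G.embed x)) : φ = ψ :=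
  IsometryEquiv.ext fun w =>
    congrFun (G.denseRange_embed.equalizer φ.continuous ψ.continuous (funext h)) w

theorem IsPure.injective_embed {G : Graphon J} (hG : G.IsPure) : Function.Injective G.embed :=
  fun x y h => hG.eq_of_simDist_eq_zero (by rw [← dist_embed, h, dist_self])

/-- The function `W` on the image of `J` in the completion, extended by zero. -/
noncomputable def extendW : G.SimCompletion × G.SimCompletion → ℝ :=
  Function.extend (Prod.map G.embed G.embed) (Function.uncurry G.W) 0

theorem extendW_mem_Icc (w : G.SimCompletion × G.SimCompletion) :
    G.extendW w ∈ Icc (0 : ℝ) 1 := by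
  unfold extendW Function.extend
  split_ifs with h
  · exact G.mem_Icc _ _
  · exact ⟨le_rfl, zero_le_one⟩

theorem IsPure.extendW_embed {G : Graphon J} (hG : G.IsPure) (x y : J) :
    G.extendW (G.embed x, G.embed y) = G.W x y :=
  (hG.injective_embed.prodMap hG.injective_embed).extend_apply _ _ (x, y)

theorem IsPure.dense_of_ae {G : Graphon J} (hG : G.IsPure) {P : J → Prop} (h : ∀ᵐ x ∂G.π, P x) :
    Dense {x : G.NbhdSpace | P (G.toNbhd.symm x)} := by
  refine dense_iff_inter_open.2 fun U hU hne => ?_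
  by_contra hempty
  refine (hG.full_support U hU hne).ne' (measure_mono_null (fun x hx => ?_) (ae_iff.1 h))
  exact fun hPx => hempty ⟨G.toNbhd x, hx, hPx⟩

variable [StandardBorelSpace J]

instance : SecondCountableTopology G.SimSpace :=
  (UniformSpace.Completion.isUniformInducing_coe
    G.SimSpace).isInducing.secondCountableTopology

/-- Open sets pull back to countable unions of `r̄_W`-balls by second countability, and these balls
are measurable because `r̄_W` is jointly measurable. -/
theorem measurable_embed : Measurable G.embed := by
  refine measurable_of_isOpen fun U hU => ?_
  have hV : IsOpen {x : G.SimSpace | (x : G.SimCompletion) ∈ U} :=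
    hU.preimage (UniformSpace.Completion.continuous_coe _)
  choose! r hr hrU using Metric.isOpen_iff.1 hV
  obtain ⟨T, hTV, hT, hTU⟩ := TopologicalSpace.isOpen_biUnion_countable
    {x : G.SimSpace | (x : G.SimCompletion) ∈ U} (fun x => Metric.ball x (r x))
    fun _ _ => Metric.isOpen_ball
  have e : G.embed ⁻¹' U = ⋃ x ∈ T, {y : J | G.simDist y (G.toSim.symm x) < r x} := by
    ext y
    have hy := Set.ext_iff.1 hTU (G.toSim y)
    simp only [mem_iUnion, Metric.mem_ball, exists_prop] at hy
    simp only [mem_iUnion, exists_prop]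
    refine Iff.trans ⟨fun h => ?_, ?_⟩ hy.symm
    · exact ⟨G.toSim y, h, by rw [dist_self]; exact hr _ h⟩
    · rintro ⟨x, hx, hxy⟩
      exact hrU x hx hxy
  rw [e]
  refine MeasurableSet.biUnion hT fun x _ => measurableSet_lt ?_ measurable_const
  exact G.square.measurable_nbhdDist.comp measurable_prodMk_right

/-- Lusin–Souslin: `J` becomes a Borel subset of its completion. -/
theorem IsPure.measurableEmbedding_embed {G : Graphon J} (hG : G.IsPure) :
    MeasurableEmbedding G.embed :=
  G.measurable_embed.measurableEmbedding hG.injective_embed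

theorem IsPure.measurableEmbedding_prodMap_embed {G : Graphon J} (hG : G.IsPure) :
    MeasurableEmbedding (Prod.map G.embed G.embed) :=
  (G.measurable_embed.prodMap G.measurable_embed).measurableEmbedding
    (hG.injective_embed.prodMap hG.injective_embed)

/-- The image of the measure of a graphon on the completion of `(J, r̄_W)`. -/
noncomputable def embedMeasure : Measure G.SimCompletion := G.π.map G.embed

instance : IsProbabilityMeasure G.embedMeasure :=
  Measure.isProbabilityMeasure_map G.measurable_embed.aemeasurable

theorem embedMeasure_prod :
    G.embedMeasure.prod G.embedMeasure = (G.π.prod G.π).map (Prod.map G.embed G.embed) :=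
  Measure.map_prod_map _ _ G.measurable_embed G.measurable_embed

theorem IsPure.measurable_extendW {G : Graphon J} (hG : G.IsPure) : Measurable G.extendW :=
  hG.measurableEmbedding_prodMap_embed.measurable_extend G.measurable_W measurable_zero

theorem Aut.extend_embed {G : Graphon J} (σ : G.Aut) (x : J) :
    σ.extend (G.embed x) = G.embed (σ.toPerm x) := σ.extend_coe x

theorem Aut.measurePreserving_extend {G : Graphon J} (σ : G.Aut) :
    MeasurePreserving σ.extend G.embedMeasure G.embedMeasure := by
  refine ⟨σ.extend.continuous.measurable, ?_⟩
  have hσ : MeasurePreserving σ.toPerm G.π G.π := σ.2.1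
  have e : σ.extend ∘ G.embed = G.embed ∘ σ.toPerm := funext σ.extend_embed
  rw [embedMeasure, Measure.map_map σ.extend.continuous.measurable G.measurable_embed, e,
    ← Measure.map_map G.measurable_embed hσ.measurable, hσ.map_eq]

/-- The null set in the definition of an automorphism depends on `x`; the product form is the one
that survives limits. -/
theorem Aut.extendW_comp_ae_eq {G : Graphon J} (hG : G.IsPure) (σ : G.Aut) :
    G.extendW ∘ Prod.map σ.extend σ.extend =ᵐ[G.embedMeasure.prod G.embedMeasure] G.extendW := by
  have hσ : MeasurePreserving σ.toPerm G.π G.π := σ.2.1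
  rw [embedMeasure_prod]
  refine hG.measurableEmbedding_prodMap_embed.ae_map_iff.2 ?_
  have hm : MeasurableSet {p : J × J | G.W (σ.toPerm p.1) (σ.toPerm p.2) = G.W p.1 p.2} :=
    measurableSet_eq_fun (G.measurable_W.comp (hσ.measurable.prodMap hσ.measurable)) G.measurable_W
  have h : ∀ᵐ p ∂G.π.prod G.π, G.W (σ.toPerm p.1) (σ.toPerm p.2) = G.W p.1 p.2 :=
    (Measure.ae_prod_iff_ae_ae hm).2 (Filter.Eventually.of_forall σ.2.2)
  filter_upwards [h] with p hp
  have e : G.extendW (σ.extend (G.embed p.1), σ.extend (G.embed p.2)) =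
      G.extendW (G.embed p.1, G.embed p.2) := by
    rwa [Aut.extend_embed, Aut.extend_embed, hG.extendW_embed, hG.extendW_embed]
  exact e

/-! ### Limits of automorphisms are automorphisms -/

/-- An isometry of the completion is a uniform limit of automorphisms. -/
def IsAutLimit (φ : G.SimCompletion ≃ᵢ G.SimCompletion) : Prop :=
  ∀ ε > 0, ∃ σ : G.Aut, ∀ w, dist (σ.extend w) (φ w) < ε

variable {G}
variable {φ : G.SimCompletion ≃ᵢ G.SimCompletion}

theorem isAutLimit_of_mem_closure (h : φ ∈ closure (range G.extendHom)) : G.IsAutLimit φ := by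
  intro ε hε
  obtain ⟨_, hψ, σ, rfl⟩ :=
    mem_closure_iff_nhds.1 h _ (φ.setOf_forall_dist_lt_mem_nhds hε)
  exact ⟨σ, hψ⟩

theorem IsAutLimit.symm (h : G.IsAutLimit φ) : G.IsAutLimit φ.symm := by
  intro ε hε
  obtain ⟨σ, hσ⟩ := h ε hε
  refine ⟨σ⁻¹, fun w => ?_⟩
  have e : (σ⁻¹).extend = σ.extend⁻¹ := map_inv G.extendHom σ
  have h1 := hσ (φ.symm w)
  rw [φ.apply_symm_apply] at h1
  rw [e, ← σ.extend.dist_eq, IsometryEquiv.apply_inv_self, dist_comm]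
  exact h1

theorem IsAutLimit.measurePreserving (h : G.IsAutLimit φ) :
    MeasurePreserving φ G.embedMeasure G.embedMeasure :=
  .of_forall_exists_dist_lt φ.continuous fun ε hε =>
    let ⟨σ, hσ⟩ := h ε hε
    ⟨σ.extend, σ.measurePreserving_extend, hσ⟩

theorem IsAutLimit.extendW_comp_ae_eq (hG : G.IsPure) (h : G.IsAutLimit φ) :
    G.extendW ∘ Prod.map φ φ =ᵐ[G.embedMeasure.prod G.embedMeasure] G.extendW := by
  refine (h.measurePreserving.prod h.measurePreserving).comp_ae_eq_of_forall_exists_dist_lt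
    (Integrable.of_mem_Icc 0 1 hG.measurable_extendW.aemeasurable
      (Filter.Eventually.of_forall G.extendW_mem_Icc)) fun ε hε => ?_
  obtain ⟨σ, hσ⟩ := h ε hε
  exact ⟨Prod.map σ.extend σ.extend,
    σ.measurePreserving_extend.prod σ.measurePreserving_extend, σ.extendW_comp_ae_eq hG,
    fun w => max_lt (hσ _) (hσ _)⟩

/-- The change of variable by `φ` allows sections to be compared along `φ` without knowing that `φ`
maps `J` into itself. -/
theorem IsAutLimit.nbhdDist_eq (hG : G.IsPure) (h : G.IsAutLimit φ) (p q : J) :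
    G.nbhdDist p q = ∫ y, |G.extendW (G.embed p, φ (G.embed y)) -
      G.extendW (G.embed q, φ (G.embed y))| ∂G.π := by
  have e1 := hG.measurableEmbedding_embed.integral_map (μ := G.π) fun w =>
    |G.extendW (G.embed p, φ w) - G.extendW (G.embed q, φ w)|
  have e2 := hG.measurableEmbedding_embed.integral_map (μ := G.π) fun w =>
    |G.extendW (G.embed p, w) - G.extendW (G.embed q, w)|
  have e3 := h.measurePreserving.integral_comp
    φ.toHomeomorph.measurableEmbedding fun w =>
      |G.extendW (G.embed p, w) - G.extendW (G.embed q, w)|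
  rw [← e1]
  refine Eq.trans ?_ e3.symm
  refine Eq.trans ?_ e2.symm
  simp only [hG.extendW_embed, nbhdDist]

/-- The isometry `φ` sends `x` to the point `p` of `J` and preserves the section of `W` at `x`. -/
def IsAutPoint (φ : G.SimCompletion ≃ᵢ G.SimCompletion) (x p : J) : Prop :=
  G.embed p = φ (G.embed x) ∧ ∀ᵐ y ∂G.π, G.extendW (G.embed p, φ (G.embed y)) = G.W x y

/-- `J` has full measure in the completion, hence so does its preimage under `φ`; Fubini splits the
invariance of `W` into sections. -/
theorem IsAutLimit.ae_exists_isAutPoint (hG : G.IsPure) (h : G.IsAutLimit φ) :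
    ∀ᵐ x ∂G.π, ∃ p, IsAutPoint φ x p := by
  have h1 : ∀ᵐ w ∂G.embedMeasure, w ∈ range G.embed :=
    hG.measurableEmbedding_embed.ae_map_iff.2
      (Filter.Eventually.of_forall fun x => mem_range_self x)
  have h2 := hG.measurableEmbedding_embed.ae_map_iff.1
    (h.measurePreserving.quasiMeasurePreserving.ae h1)
  have h3 := h.extendW_comp_ae_eq hG
  rw [embedMeasure_prod] at h3
  have h4 := Measure.ae_ae_of_ae_prod (hG.measurableEmbedding_prodMap_embed.ae_map_iff.1 h3)
  filter_upwards [h2, h4] with x ⟨p, hp⟩ hx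
  refine ⟨p, hp, ?_⟩
  filter_upwards [hx] with y hy
  rw [hp, ← hG.extendW_embed]
  exact hy

theorem IsAutLimit.dist_eq_of_isAutPoint (hG : G.IsPure) (h : G.IsAutLimit φ) {x y p q : J}
    (hp : IsAutPoint φ x p) (hq : IsAutPoint φ y q) : G.nbhdDist p q = G.nbhdDist x y := by
  rw [h.nbhdDist_eq hG]
  refine integral_congr_ae ?_
  filter_upwards [hp.2, hq.2] with z h1 h2
  rw [h1, h2]

theorem IsPure.integrable_extendW (hG : G.IsPure) (φ : G.SimCompletion ≃ᵢ G.SimCompletion)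
    (p : J) : Integrable (fun y => G.extendW (G.embed p, φ (G.embed y))) G.π := by
  refine Integrable.of_mem_Icc 0 1 (Measurable.aemeasurable ?_)
    (Filter.Eventually.of_forall fun _ => G.extendW_mem_Icc _)
  exact hG.measurable_extendW.comp (measurable_const.prodMk
    (φ.continuous.measurable.comp G.measurable_embed))

/-- Good points are dense and `φ` preserves `r_W` on them, so the images of good points tending to
`x` are `r_W`-Cauchy and converge in `J`. -/
theorem IsAutLimit.exists_isAutPoint (hG : G.IsPure) (h : G.IsAutLimit φ) (x : J) :
    ∃ p, IsAutPoint φ x p := by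
  obtain ⟨u, hu, hux⟩ := mem_closure_iff_seq_limit.1
    (hG.dense_of_ae (h.ae_exists_isAutPoint hG) (G.toNbhd x))
  choose p hp using hu
  have := hG.complete
  have hcau : CauchySeq fun n => G.toNbhd (p n) := by
    refine Metric.cauchySeq_iff.2 fun ε hε => ?_
    obtain ⟨N, hN⟩ := Metric.cauchySeq_iff.1 hux.cauchySeq ε hε
    refine ⟨N, fun m hm n hn => ?_⟩
    rw [dist_toNbhd, h.dist_eq_of_isAutPoint hG (hp m) (hp n)]
    exact hN m hm n hn
  obtain ⟨q, hq⟩ := cauchySeq_tendsto_of_complete hcau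
  refine ⟨G.toNbhd.symm q, ?_, ?_⟩
  -- `r_W`-convergence implies `r̄_W`-convergence, so uniqueness of limits identifies `q` with `φ
  -- x`.
  · have l1 := (G.continuous_embed_nbhd.tendsto q).comp hq
    have l2 := (φ.continuous.tendsto _).comp ((G.continuous_embed_nbhd.tendsto _).comp hux)
    refine tendsto_nhds_unique l1 (l2.congr fun n => ?_)
    exact (hp n).1.symm
  · have i0 : Integrable (fun y =>
        |G.extendW (G.embed (G.toNbhd.symm q), φ (G.embed y)) - G.W x y|) G.π :=
      ((hG.integrable_extendW φ _).sub (G.integrable_section x)).abs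
    -- The `L¹` triangle inequality through the section at `p n`, which agrees along `φ` with the
    -- section at `u n`.
    have hle : ∀ n, ∫ y, |G.extendW (G.embed (G.toNbhd.symm q), φ (G.embed y)) - G.W x y| ∂G.π ≤
        dist (G.toNbhd (p n)) q + dist (u n) (G.toNbhd x) := by
      intro n
      have e1 : dist (G.toNbhd (p n)) q = _ := h.nbhdDist_eq hG (p n) (G.toNbhd.symm q)
      have i1 : Integrable (fun y => |G.extendW (G.embed (p n), φ (G.embed y)) -
          G.extendW (G.embed (G.toNbhd.symm q), φ (G.embed y))|) G.π :=
        ((hG.integrable_extendW φ _).sub (hG.integrable_extendW φ _)).abs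
      have e2 : dist (u n) (G.toNbhd x) =
        ∫ y, |G.W (G.toNbhd.symm (u n)) y - G.W x y| ∂G.π := rfl
      rw [e1, e2, ← integral_add i1 (G.integrable_abs_sub _ _)]
      refine integral_mono_ae i0 (i1.add (G.integrable_abs_sub _ _)) ?_
      filter_upwards [(hp n).2] with y hy
      rw [← hy, abs_sub_comm (G.extendW (G.embed (p n), φ (G.embed y)))]
      exact abs_sub_le _ _ _
    have hlim := (tendsto_iff_dist_tendsto_zero.1 hq).add (tendsto_iff_dist_tendsto_zero.1 hux)
    rw [add_zero] at hlim
    have h0 := le_antisymm (ge_of_tendsto' hlim hle) (integral_nonneg fun _ => abs_nonneg _)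
    filter_upwards [(integral_eq_zero_iff_of_nonneg (fun _ => abs_nonneg _)
      i0).1 h0] with y hy
    exact sub_eq_zero.1 (abs_eq_zero.1 hy)

theorem IsAutLimit.mem_range_extendHom (hG : G.IsPure) (h : G.IsAutLimit φ) :
    φ ∈ range G.extendHom := by
  choose p hp hpW using h.exists_isAutPoint hG
  choose q hq _ using h.symm.exists_isAutPoint hG
  let σ : Equiv.Perm J :=
    { toFun := p
      invFun := q
      left_inv := fun x => hG.injective_embed (by rw [hq, hp, φ.symm_apply_apply])
      right_inv := fun x => hG.injective_embed (by rw [hp, hq, φ.apply_symm_apply]) }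
  have e : G.embed ∘ p = φ ∘ G.embed := funext hp
  have hpm : Measurable p := hG.measurableEmbedding_embed.measurable_comp_iff.1
    (e ▸ φ.continuous.measurable.comp G.measurable_embed)
  have hmp : MeasurePreserving σ G.π G.π := by
    refine ⟨hpm, ?_⟩
    have h1 : (G.π.map p).map G.embed = G.π.map G.embed := by
      rw [Measure.map_map G.measurable_embed hpm, e,
        ← Measure.map_map φ.continuous.measurable G.measurable_embed]
      exact h.measurePreserving.map_eq
    have h2 := congrArg (Measure.comap G.embed) h1
    rwa [hG.measurableEmbedding_embed.comap_map, hG.measurableEmbedding_embed.comap_map] at h2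
  have haut : G.IsAutomorphism σ := by
    refine ⟨hmp, fun x => ?_⟩
    filter_upwards [hpW x] with y hy
    rw [← hy, ← hp, hG.extendW_embed]
    rfl
  let τ : G.Aut := ⟨σ, haut⟩
  exact ⟨τ, G.isometryEquiv_ext_embed fun x => (τ.extend_embed x).trans (hp x)⟩

end Graphon

/-! ### The topological group of automorphisms -/

namespace Graphon

variable {J : Type*} [MeasurableSpace J] [StandardBorelSpace J] {G : Graphon J}

theorem dist_extend_le (σ τ : G.Aut) (w : G.SimCompletion) :
    dist (σ.extend w) (τ.extend w) ≤ dist σ τ :=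
  le_ciSup (bddAbove_dist_extend σ τ) w

theorem dist_aut_le {σ τ : G.Aut} {r : ℝ} (hr : 0 ≤ r)
    (h : ∀ w, dist (σ.extend w) (τ.extend w) ≤ r) : dist σ τ ≤ r :=
  Real.iSup_le h hr

theorem Aut.extend_mul (σ τ : G.Aut) : (σ * τ).extend = σ.extend * τ.extend :=
  map_mul G.extendHom σ τ

theorem Aut.extend_inv (σ : G.Aut) : (σ⁻¹).extend = σ.extend⁻¹ :=
  map_inv G.extendHom σ

instance : IsTopologicalGroup G.Aut where
  continuous_mul := by
    -- Each factor contributes at most the maximum distance on the product, hence the constant `2`.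
    refine (LipschitzWith.of_dist_le' (K := 2) fun p q => ?_).continuous
    refine dist_aut_le (by positivity) fun w => ?_
    have h1 := dist_triangle (p.1.extend (p.2.extend w)) (q.1.extend (p.2.extend w))
      (q.1.extend (q.2.extend w))
    rw [q.1.extend.dist_eq] at h1
    have h2 := dist_extend_le p.1 q.1 (p.2.extend w)
    have h3 := dist_extend_le p.2 q.2 w
    have h4 : dist p.1 q.1 ≤ dist p q := le_max_left _ _
    have h5 : dist p.2 q.2 ≤ dist p q := le_max_right _ _
    rw [Aut.extend_mul, Aut.extend_mul, IsometryEquiv.mul_apply, IsometryEquiv.mul_apply]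
    linarith
  continuous_inv := by
    refine (LipschitzWith.of_dist_le' (K := 1) fun σ τ => ?_).continuous
    refine dist_aut_le (by positivity) fun w => ?_
    rw [one_mul, Aut.extend_inv, Aut.extend_inv, ← σ.extend.dist_eq,
      IsometryEquiv.apply_inv_self, dist_comm]
    have h := dist_extend_le σ τ (τ.extend⁻¹ w)
    rwa [IsometryEquiv.apply_inv_self] at h

theorem IsPure.injective_extendHom (hG : G.IsPure) : Function.Injective G.extendHom := by
  intro σ τ h
  refine Subtype.ext (Equiv.ext fun x => hG.injective_embed ?_)
  have h1 := congrArg (fun φ : G.SimCompletion ≃ᵢ G.SimCompletion => φ (G.embed x)) h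
  exact (σ.extend_embed x).symm.trans (Eq.trans h1 (τ.extend_embed x))

/-- By compactness of the completion, pointwise neighborhoods of an isometry contain uniform ones,
so the supremum metric induces no finer topology. -/
theorem isInducing_extendHom : Topology.IsInducing G.extendHom := by
  refine Topology.isInducing_iff_nhds.2 fun σ => le_antisymm ?_ ?_
  · have hc : Continuous G.extendHom := continuous_induced_rng.2 <| continuous_pi fun w =>
      (LipschitzWith.of_dist_le' (K := 1) fun σ τ => by
        rw [one_mul]
        exact dist_extend_le σ τ w).continuous
    exact Filter.tendsto_iff_comap.1 (hc.tendsto σ)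
  · intro s hs
    obtain ⟨ε, hε, hs⟩ := Metric.mem_nhds_iff.1 hs
    -- Halving `ε` restores the strict inequality lost in the supremum.
    refine ⟨_, σ.extend.setOf_forall_dist_lt_mem_nhds (half_pos hε), fun τ hτ => hs ?_⟩
    exact (dist_aut_le (half_pos hε).le fun w => (hτ w).le).trans_lt (half_lt_self hε)

theorem IsPure.isClosedEmbedding_extendHom (hG : G.IsPure) :
    Topology.IsClosedEmbedding G.extendHom :=
  ⟨⟨isInducing_extendHom, hG.injective_extendHom⟩, isClosed_of_closure_subset fun _ hφ =>
    (isAutLimit_of_mem_closure hφ).mem_range_extendHom hG⟩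

end Graphon

theorem mainTheorem2 {J : Type*} [MeasurableSpace J] [StandardBorelSpace J]
    (G : Graphon J) (hG : G.IsPure) :
    (∀ x y : J, G.simDist x y = 0 → x = y) ∧
    CompactSpace G.SimCompletion ∧
    CompactSpace (G.SimCompletion ≃ᵢ G.SimCompletion) ∧
    Topology.IsClosedEmbedding G.extendHom ∧
    (∀ σ τ : G.Aut, dist σ τ = 0 → σ = τ) ∧
    IsTopologicalGroup G.Aut ∧
    CompactSpace G.Aut := by
  have hcomp : CompactSpace (G.SimCompletion ≃ᵢ G.SimCompletion) := IsometryEquiv.compactSpace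
  have hemb := hG.isClosedEmbedding_extendHom
  refine ⟨fun x y => hG.eq_of_simDist_eq_zero, inferInstance, hcomp, hemb, fun σ τ h => ?_,
    inferInstance, hemb.compactSpace⟩
  refine hG.injective_extendHom (IsometryEquiv.ext fun w => dist_le_zero.1 ?_)
  exact h ▸ Graphon.dist_extend_le σ τ w
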